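/- Let $G$ be a compact (Hausdorff topological) group with neutral element $e$ and normalized Haar measure $d\sigma$, and let $\widehat G$ be the set of equivalence classes of its (continuous) irreducible unitary representations. For each class $\pi\in\widehat G$ let $d_\pi$ be its dimension. Let $(\mu_t)_{t\ge 0}$ be a vaguely continuous convolution semigroup of Borel probability measures on $G$ with $\mu_0=\delta_e$, such that every $\mu_t$ is central ($\mu_t(\sigma A\sigma^{-1})=\mu_t(A)$ for all $\sigma\in G$ and Borel $A$) and symmetric ($\mu_t(A^{-1})=\mu_t(A)$). Suppose that for each $t>0$ the measure $\mu_t$ is absolutely continuous with respect to Haar measure, with a continuous density $k_t:G\to\mathbb R$, and put $h_t(\sigma,\rho)=k_t(\sigma^{-1}\rho)$. Then there are real numbers $\alpha_\pi\le 0$ $(\pi\in\widehat G)$, independent of $t$, with $$\int_G \pi(\sigma)\,\mu_t(d\sigma)=e^{t\alpha_\pi}I_\pi\qquad(t\ge 0,\ \pi\in\widehat G),$$ where $I_\pi$ is the identity matrix of size $d_\pi$, and, for every $t>0$ and every choice, for each class $\pi\in\widehat G$, of a representative acting by unitary $d_\pi\times d_\pi$ matrices $\pi(\sigma)=(\pi_{ij}(\sigma))_{1\le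 i,j\le d_\pi}$, $$h_t(\sigma,\rho)=\sum_{\pi\in\widehat G}\ \sum_{i,j=1}^{d_\pi}d_\pi\,e^{t\alpha_\pi}\,\overline{\pi_{ij}(\sigma)}\,\pi_{ij}(\rho)\qquad\text{for all }\sigma,\rho\in G,$$ where the (unordered) sum over $\widehat G$ converges uniformly in $(\sigma,\rho)\in G\times G$. -/

import Mathlib

open MeasureTheory Filter
open scoped NNReal

namespace CptGroup

/-- A continuous irreducible unitary (matrix) representation of `G`, of dimension `dim ≥ 1`. -/
structure Irrep (G : Type*) [Group G] [TopologicalSpace G] where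
  /-- the dimension `d_π` -/
  dim : ℕ
  dim_pos : 0 < dim
  /-- the representation, with values in the unitary matrices -/
  rep : G →* Matrix.unitaryGroup (Fin dim) ℂ
  continuous_rep : Continuous rep
  /-- the only invariant subspaces of `ℂ ^ dim` are the trivial ones -/
  irreducible : ∀ W : Submodule ℂ (Fin dim → ℂ),
    (∀ g : G, ∀ v ∈ W, (rep g : Matrix (Fin dim) (Fin dim) ℂ).mulVec v ∈ W) → W = ⊥ ∨ W = ⊤

/-- The coordinate function `π_ij (σ) = π(σ)_ij`. -/
def Irrep.coord {G : Type*} [Group G] [TopologicalSpace G] (π : Irrep G)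
    (i j : Fin π.dim) (σ : G) : ℂ :=
  (π.rep σ : Matrix (Fin π.dim) (Fin π.dim) ℂ) i j

/-- Equivalence of representations: there is an invertible linear intertwiner. -/
def Irrep.Equivalent {G : Type*} [Group G] [TopologicalSpace G] (π π' : Irrep G) : Prop :=
  ∃ T : (Fin π.dim → ℂ) ≃ₗ[ℂ] (Fin π'.dim → ℂ), ∀ (g : G) (v : Fin π.dim → ℂ),
    T ((π.rep g : Matrix (Fin π.dim) (Fin π.dim) ℂ).mulVec v) =
      (π'.rep g : Matrix (Fin π'.dim) (Fin π'.dim) ℂ).mulVec (T v)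

instance Irrep.setoid (G : Type*) [Group G] [TopologicalSpace G] : Setoid (Irrep G) where
  r := Irrep.Equivalent
  iseqv :=
    { refl := fun π => ⟨LinearEquiv.refl ℂ _, fun _ _ => rfl⟩
      symm := by
        rintro π π' ⟨T, hT⟩
        refine ⟨T.symm, fun g v => ?_⟩
        apply T.injective
        rw [hT]
        simp
      trans := by
        rintro π π' π'' ⟨T, hT⟩ ⟨S, hS⟩
        refine ⟨T.trans S, fun g v => ?_⟩
        simp [hT, hS] }

/-- The unitary dual `Ĝ`: equivalence classes of irreducible unitary representations. -/
def UnitaryDual (G : Type*) [Group G] [TopologicalSpace G] : Type _ :=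
  Quotient (Irrep.setoid G)

/-- The class in `Ĝ` of an irreducible unitary representation. -/
def Irrep.cls {G : Type*} [Group G] [TopologicalSpace G] (π : Irrep G) : UnitaryDual G :=
  Quotient.mk (Irrep.setoid G) π

section Measures

variable {G : Type*} [Group G] [TopologicalSpace G] [MeasurableSpace G]

/-- The Fourier transform `μ̂(π) = ∫ π(σ) μ(dσ)`, computed entrywise. -/
noncomputable def fourier (μ : Measure G) (π : Irrep G) : Matrix (Fin π.dim) (Fin π.dim) ℂ :=
  Matrix.of fun i j => ∫ σ, π.coord i j σ ∂μ

/-- Central (conjugate-invariant) measures: `μ(σ A σ⁻¹) = μ(A)`. -/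
def IsCentral (μ : Measure G) : Prop :=
  ∀ σ : G, ∀ A : Set G, MeasurableSet A → μ ((fun x => σ * x * σ⁻¹) '' A) = μ A

/-- Symmetric measures: `μ(A⁻¹) = μ(A)`. -/
def IsSymmetric (μ : Measure G) : Prop :=
  ∀ A : Set G, MeasurableSet A → μ ((fun x => x⁻¹) '' A) = μ A

/-- `θ` is the convolution `μ * ν`, as a functional on the continuous functions. (This needs no
joint measurability of the multiplication for the product of the Borel σ-algebras.) -/
def IsConvolution (θ μ ν : Measure G) : Prop :=
  ∀ f : C(G, ℝ), ∫ x, f x ∂θ = ∫ σ, ∫ τ, f (σ * τ) ∂ν ∂μ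

/-- A vaguely continuous convolution semigroup `(μ_t, t ≥ 0)` of probability measures with
`μ_0 = δ_e`. The topology of `ProbabilityMeasure G` is that of weak convergence. -/
structure IsConvolutionSemigroup [OpensMeasurableSpace G]
    (μ : ℝ≥0 → ProbabilityMeasure G) : Prop where
  zero : (μ 0 : Measure G) = Measure.dirac 1
  add : ∀ s t : ℝ≥0,
    IsConvolution (μ (s + t) : Measure G) (μ s : Measure G) (μ t : Measure G)
  continuous : Continuous μ

/-- Normalized Haar measure on a compact group. -/
noncomputable def normHaar (G : Type*) [Group G] [TopologicalSpace G] [IsTopologicalGroup G]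
    [CompactSpace G] [MeasurableSpace G] [BorelSpace G] : Measure G :=
  Measure.haarMeasure ⊤

/-- `k` is (a version of) the density of `μ`: `μ` is absolutely continuous with respect to
normalized Haar measure and `k` is its Radon–Nikodym derivative. -/
def HasDensity [IsTopologicalGroup G] [CompactSpace G] [BorelSpace G]
    (μ : Measure G) (k : G → ℝ) : Prop :=
  μ.AbsolutelyContinuous (normHaar G) ∧
    k =ᵐ[normHaar G] fun x => (μ.rnDeriv (normHaar G) x).toReal

end Measures

/-- The transition density `h(σ, ρ) = k(σ⁻¹ρ)` associated with a density `k`. -/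
def transitionDensity {G : Type*} [Group G] (k : G → ℝ) (σ ρ : G) : ℝ :=
  k (σ⁻¹ * ρ)

end CptGroup

namespace CptGroup

/-! ### Schur's lemma and characters -/

section Schur

variable {G : Type*} [Group G] [TopologicalSpace G]

/-! Centrality makes the Fourier transform of `μ t` at `π` commute with every `π(g)`, so by Schur's
lemma it is a scalar; symmetry makes the scalar real. The convolution law makes these scalars a
continuous one-parameter semigroup bounded by `1`, hence `exp (tα)` with `α ≤ 0`
(`exists_exp_of_semigroup`).

The double sum over `i, j` is `χ_π(σ⁻¹ρ)`, and `|χ_π| ≤ d_π`, so the series is dominated by `∑ d_π²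
exp (tα_π)`. This converges: it is the Bessel sum of the continuous, hence square-integrable,
density at time `t/2` against the orthonormal characters (`summable_dim_sq_mul`). The uniform sum
has the same Fourier coefficients as the density, so the two agree by Peter–Weyl
(`HasDensity.hasSum_char`).

Peter–Weyl, in the form `eq_zero_of_forall_irrep`, comes from spectral theory. Convolution with a
nonzero Hermitian `F` is a nonzero compact self-adjoint operator commuting with left translations.
An eigenspace for a nonzero eigenvalue is finite-dimensional and invariant, so it contains an
irreducible representation; but convolution with `F` kills this if `F` is orthogonal to all
coordinate functions. -/

/-- The representing matrices. -/
def Irrep.mat (π : Irrep G) (g : G) : Matrix (Fin π.dim) (Fin π.dim) ℂ := π.rep g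

lemma Irrep.mat_apply (π : Irrep G) (g : G) (i j : Fin π.dim) : π.mat g i j = π.coord i j g := rfl

@[simp] lemma Irrep.mat_one (π : Irrep G) : π.mat 1 = 1 := by simp [Irrep.mat]

lemma Irrep.mat_mul (π : Irrep G) (g h : G) : π.mat (g * h) = π.mat g * π.mat h := by
  simp [Irrep.mat]

lemma Irrep.conjTranspose_mat (π : Irrep G) (g : G) :
    (π.mat g).conjTranspose = π.mat g⁻¹ := by
  simp [Irrep.mat, Matrix.star_eq_conjTranspose]

lemma Irrep.coord_inv (π : Irrep G) (i j : Fin π.dim) (g : G) :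
    π.coord i j g⁻¹ = (starRingEnd ℂ) (π.coord j i g) := by
  rw [← π.mat_apply, ← π.conjTranspose_mat]; rfl

@[fun_prop] lemma Irrep.continuous_coord (π : Irrep G) (i j : Fin π.dim) : Continuous (π.coord i j) :=
  (continuous_subtype_val.comp π.continuous_rep).matrix_elem i j

@[fun_prop] lemma Irrep.continuous_mat (π : Irrep G) : Continuous π.mat :=
  continuous_subtype_val.comp π.continuous_rep

lemma Irrep.norm_coord_le (π : Irrep G) (i j : Fin π.dim) (g : G) : ‖π.coord i j g‖ ≤ 1 :=
  entry_norm_bound_of_unitary (π.rep g).2 i j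

/-- Kernel and range of an intertwiner are invariant subspaces, so a nonzero intertwiner is
bijective. -/
lemma Irrep.schur_of_not_equivalent {π π' : Irrep G} (hne : ¬ π.Equivalent π')
    (P : Matrix (Fin π'.dim) (Fin π.dim) ℂ) (h : ∀ g, P * π.mat g = π'.mat g * P) : P = 0 := by
  have hL : ∀ g v, P.mulVec ((π.mat g).mulVec v) = (π'.mat g).mulVec (P.mulVec v) := by
    intro g v
    rw [Matrix.mulVec_mulVec, h, ← Matrix.mulVec_mulVec]
  by_contra hP
  have hP' : P.mulVecLin ≠ 0 := fun h0 => hP (by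
    ext i j
    have := congrFun (LinearMap.congr_fun h0 (Pi.single j 1)) i
    simpa using this)
  have hker : LinearMap.ker P.mulVecLin = ⊥ := by
    refine (π.irreducible _ ?_).resolve_right fun ht => hP' (LinearMap.ker_eq_top.1 ht)
    intro g v hv
    simp only [LinearMap.mem_ker, Matrix.mulVecLin_apply] at hv ⊢
    exact (hL g v).trans (by rw [hv, Matrix.mulVec_zero])
  have hran : LinearMap.range P.mulVecLin = ⊤ := by
    refine (π'.irreducible _ ?_).resolve_left fun ht => hP' (LinearMap.range_eq_bot.1 ht)
    rintro g _ ⟨v, rfl⟩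
    exact ⟨(π.mat g).mulVec v, hL g v⟩
  exact hne ⟨LinearEquiv.ofBijective P.mulVecLin
    ⟨LinearMap.ker_eq_bot.1 hker, LinearMap.range_eq_top.1 hran⟩, fun g v => hL g v⟩

/-- An eigenspace of `P` is a nonzero invariant subspace, hence everything. -/
lemma Irrep.schur_scalar (π : Irrep G) (P : Matrix (Fin π.dim) (Fin π.dim) ℂ)
    (h : ∀ g, P * π.mat g = π.mat g * P) :
    ∃ c : ℂ, P = c • (1 : Matrix (Fin π.dim) (Fin π.dim) ℂ) := by
  have : Nonempty (Fin π.dim) := ⟨⟨0, π.dim_pos⟩⟩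
  obtain ⟨c, hc⟩ := Module.End.exists_eigenvalue (P.mulVecLin : Module.End ℂ (Fin π.dim → ℂ))
  refine ⟨c, ?_⟩
  have htop := (π.irreducible (Module.End.eigenspace P.mulVecLin c) ?_).resolve_left hc
  · ext i j
    have hj : (Pi.single j 1 : Fin π.dim → ℂ) ∈ Module.End.eigenspace P.mulVecLin c := by
      rw [htop]; trivial
    rw [Module.End.mem_eigenspace_iff] at hj
    have := congrFun hj i
    simpa [Matrix.one_apply, Pi.single_apply] using this
  · intro g v hv
    rw [Module.End.mem_eigenspace_iff, Matrix.mulVecLin_apply] at hv ⊢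
    change P.mulVec ((π.mat g).mulVec v) = c • (π.mat g).mulVec v
    rw [Matrix.mulVec_mulVec, h, ← Matrix.mulVec_mulVec, hv, Matrix.mulVec_smul]

/-- The character `χ_π`. -/
noncomputable def Irrep.char (π : Irrep G) (g : G) : ℂ := (π.mat g).trace

lemma Irrep.char_eq (π : Irrep G) (g : G) : π.char g = ∑ i, π.coord i i g := rfl

@[fun_prop] lemma Irrep.continuous_char (π : Irrep G) : Continuous π.char :=
  continuous_finsetSum Finset.univ fun i _ => π.continuous_coord i i

lemma Irrep.norm_char_le (π : Irrep G) (g : G) : ‖π.char g‖ ≤ π.dim := by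
  refine (norm_sum_le _ _).trans ((Finset.sum_le_sum fun i _ => π.norm_coord_le i i g).trans ?_)
  simp

lemma Irrep.char_inv (π : Irrep G) (g : G) : π.char g⁻¹ = (starRingEnd ℂ) (π.char g) := by
  simp [char_eq, coord_inv]

lemma Irrep.sum_conj_coord_mul_coord (π : Irrep G) (σ ρ : G) :
    ∑ i, ∑ j, (starRingEnd ℂ) (π.coord i j σ) * π.coord i j ρ = π.char (σ⁻¹ * ρ) := by
  rw [Finset.sum_comm, char, mat_mul, Matrix.trace]
  refine Finset.sum_congr rfl fun j _ => ?_
  rw [Matrix.diag_apply, Matrix.mul_apply]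
  simp only [mat_apply, coord_inv]

/-- An intertwiner of equivalent representations, as an invertible matrix. -/
lemma Irrep.Equivalent.exists_matrix {π π' : Irrep G} (h : π.Equivalent π') :
    ∃ (P : Matrix (Fin π'.dim) (Fin π.dim) ℂ) (Q : Matrix (Fin π.dim) (Fin π'.dim) ℂ),
      P * Q = 1 ∧ Q * P = 1 ∧ ∀ g, P * π.mat g = π'.mat g * P := by
  obtain ⟨T, hT⟩ := h
  refine ⟨LinearMap.toMatrix' T.toLinearMap, LinearMap.toMatrix' T.symm.toLinearMap, ?_, ?_, ?_⟩
  · rw [← LinearMap.toMatrix'_comp]; simp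
  · rw [← LinearMap.toMatrix'_comp]; simp
  · intro g
    apply Matrix.toLin'.injective
    ext1 i
    ext1
    simp only [LinearMap.comp_apply, Matrix.toLin'_mul, Matrix.toLin'_toMatrix',
      Matrix.toLin'_apply, LinearEquiv.coe_coe]
    exact hT g _

lemma Irrep.Equivalent.char_eq {π π' : Irrep G} (h : π.Equivalent π') : π.char = π'.char := by
  obtain ⟨P, Q, hPQ, hQP, hP⟩ := h.exists_matrix
  ext g
  have : π'.mat g = P * π.mat g * Q := by rw [hP, Matrix.mul_assoc, hPQ, Matrix.mul_one]
  rw [Irrep.char, Irrep.char, this, Matrix.trace_mul_comm, ← Matrix.mul_assoc, hQP, Matrix.one_mul]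

lemma Irrep.cls_eq_iff {π π' : Irrep G} : π.cls = π'.cls ↔ π.Equivalent π' :=
  Quotient.eq (r := Irrep.setoid G)

lemma Irrep.continuous_average_integrand [IsTopologicalGroup G] (π π' : Irrep G)
    (X : Matrix (Fin π'.dim) (Fin π.dim) ℂ) :
    Continuous fun x => π'.mat x⁻¹ * X * π.mat x :=
  (((π'.continuous_mat.comp continuous_inv).matrix_mul continuous_const)).matrix_mul
    π.continuous_mat

end Schur

section Integral

lemma integrable_of_continuous {X : Type*} [TopologicalSpace X] [CompactSpace X]
    [MeasurableSpace X] [OpensMeasurableSpace X] {μ : Measure X} [IsFiniteMeasure μ] {f : X → ℂ}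
    (hf : Continuous f) : Integrable f μ :=
  hf.integrable_of_hasCompactSupport (HasCompactSupport.of_compactSpace f)

lemma matrix_integral_mul_left {X : Type*} [MeasurableSpace X] {μ : Measure X} {m n p : Type*} [Fintype m]
    (A : Matrix n m ℂ) (f : X → Matrix m p ℂ) (hf : ∀ i j, Integrable (fun x => f x i j) μ) :
    (Matrix.of fun i j => ∫ x, (A * f x) i j ∂μ) = A * Matrix.of fun i j => ∫ x, f x i j ∂μ := by
  ext i j
  simp only [Matrix.mul_apply, Matrix.of_apply]
  rw [integral_finsetSum _ fun k _ => (hf k j).const_mul _]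
  simp only [integral_const_mul]

lemma matrix_integral_mul_right {X : Type*} [MeasurableSpace X] {μ : Measure X} {m n p : Type*} [Fintype m]
    (A : Matrix m p ℂ) (f : X → Matrix n m ℂ) (hf : ∀ i j, Integrable (fun x => f x i j) μ) :
    (Matrix.of fun i j => ∫ x, (f x * A) i j ∂μ) = (Matrix.of fun i j => ∫ x, f x i j ∂μ) * A := by
  ext i j
  simp only [Matrix.mul_apply, Matrix.of_apply]
  rw [integral_finsetSum _ fun k _ => (hf i k).mul_const _]
  simp only [integral_mul_const]

end Integral

/-! ### Invariance of Haar measure and the orthogonality relations -/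

section Haar

variable {G : Type*} [Group G] [TopologicalSpace G] [IsTopologicalGroup G]
    [CompactSpace G] [MeasurableSpace G] [BorelSpace G]

instance : (normHaar G).IsHaarMeasure := by unfold normHaar; infer_instance

instance : (normHaar G).Regular := by unfold normHaar; infer_instance

instance : IsProbabilityMeasure (normHaar G) :=
  ⟨by simpa [normHaar] using Measure.haarMeasure_self (K₀ := (⊤ : TopologicalSpace.PositiveCompacts G))⟩

/-- A right translate is again a regular Haar probability measure, and such a measure is unique.
Inversion is handled the same way, right invariance turning into left invariance of the inverted
measure. -/
instance : (normHaar G).IsMulRightInvariant := by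
  refine ⟨fun g => ?_⟩
  have : IsProbabilityMeasure (Measure.map (· * g) (normHaar G)) :=
    Measure.isProbabilityMeasure_map (continuous_mul_const g).measurable.aemeasurable
  have : (Measure.map (· * g) (normHaar G)).Regular := Measure.Regular.map (Homeomorph.mulRight g)
  exact Measure.isHaarMeasure_eq_of_isProbabilityMeasure _ _

instance : (normHaar G).IsInvInvariant := by
  refine ⟨?_⟩
  have : IsProbabilityMeasure (normHaar G).inv :=
    Measure.isProbabilityMeasure_map measurable_inv.aemeasurable
  have : (normHaar G).inv.Regular := Measure.Regular.map (Homeomorph.inv G)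
  have : (normHaar G).inv.IsHaarMeasure := by
    refine Measure.isHaarMeasure_of_isCompact_nonempty_interior _ Set.univ isCompact_univ (by simp)
      (by simp) (by simp)
  exact Measure.isHaarMeasure_eq_of_isProbabilityMeasure _ _

/-- The averaged intertwiner `∫ π'(x)⁻¹ X π(x) dx`. -/
noncomputable def Irrep.average (π π' : Irrep G) (X : Matrix (Fin π'.dim) (Fin π.dim) ℂ) :
    Matrix (Fin π'.dim) (Fin π.dim) ℂ :=
  Matrix.of fun i j => ∫ x, (π'.mat x⁻¹ * X * π.mat x) i j ∂(normHaar G)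

/-- Substitute `x ↦ x * g` in the average, by right invariance. -/
lemma Irrep.average_intertwines (π π' : Irrep G) (X : Matrix (Fin π'.dim) (Fin π.dim) ℂ) (g : G) :
    π.average π' X * π.mat g = π'.mat g * π.average π' X := by
  have hi : ∀ i j, Integrable (fun x => (π'.mat x⁻¹ * X * π.mat x) i j) (normHaar G) := fun i j =>
    integrable_of_continuous ((π.continuous_average_integrand π' X).matrix_elem i j)
  rw [average, ← matrix_integral_mul_left _ _ hi, ← matrix_integral_mul_right _ _ hi]
  ext i j
  simp only [Matrix.of_apply]
  rw [← integral_mul_right_eq_self (μ := normHaar G)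
    (fun x => (π'.mat g * (π'.mat x⁻¹ * X * π.mat x)) i j) g]
  congr 1
  ext x
  have h1 : π'.mat g * π'.mat g⁻¹ = 1 := by rw [← mat_mul]; simp
  rw [mul_inv_rev, mat_mul, mat_mul]
  simp only [← Matrix.mul_assoc, h1, Matrix.one_mul]

/-- Averaging a matrix unit produces the integrals of the orthogonality relations, to which Schur's
lemma then applies. -/
lemma Irrep.average_single_apply (π π' : Irrep G) (k : Fin π'.dim) (l : Fin π.dim)
    (i : Fin π'.dim) (j : Fin π.dim) :
    π.average π' (Matrix.single k l 1) i j
      = ∫ x, (starRingEnd ℂ) (π'.coord k i x) * π.coord l j x ∂(normHaar G) := by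
  simp only [average, Matrix.of_apply]
  congr 1
  ext x
  rw [← coord_inv, Matrix.mul_apply, Finset.sum_eq_single l]
  · simp [mat_apply]
  · intro b _ hb
    rw [Matrix.mul_apply, Finset.sum_eq_zero fun a _ => by simp [hb.symm], zero_mul]
  · simp

/-- **Schur orthogonality** for inequivalent representations. -/
lemma Irrep.integral_conj_coord_mul_coord_of_not_equivalent {π π' : Irrep G}
    (h : ¬ π.Equivalent π') (k i : Fin π'.dim) (l j : Fin π.dim) :
    ∫ x, (starRingEnd ℂ) (π'.coord k i x) * π.coord l j x ∂(normHaar G) = 0 := by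
  rw [← average_single_apply,
    schur_of_not_equivalent h _ (π.average_intertwines π' (Matrix.single k l 1))]
  rfl

/-- **Schur orthogonality** for a single representation. -/
lemma Irrep.integral_conj_coord_mul_coord (π : Irrep G) (k i l j : Fin π.dim) :
    ∫ x, (starRingEnd ℂ) (π.coord k i x) * π.coord l j x ∂(normHaar G)
      = if k = l ∧ i = j then (π.dim : ℂ)⁻¹ else 0 := by
  obtain ⟨c, hc⟩ := π.schur_scalar _ (π.average_intertwines π (Matrix.single k l 1))
  have hd : (π.dim : ℂ) ≠ 0 := by exact_mod_cast π.dim_pos.ne'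
  -- The trace determines the scalar `c`, since conjugation by `π(x)` preserves traces.
  have htr : (π.average π (Matrix.single k l 1)).trace = if k = l then 1 else 0 := by
    simp only [Matrix.trace, Matrix.diag_apply, average, Matrix.of_apply]
    rw [← integral_finsetSum _ fun i _ => integrable_of_continuous
      ((π.continuous_average_integrand π _).matrix_elem i i)]
    have : ∀ x, ∑ i, (π.mat x⁻¹ * (Matrix.single k l 1 : Matrix (Fin π.dim) (Fin π.dim) ℂ) * π.mat x) i i = if k = l then 1 else 0 := by
      intro x
      change (π.mat x⁻¹ * Matrix.single k l 1 * π.mat x).trace = _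
      rw [Matrix.trace_mul_comm, ← Matrix.mul_assoc, ← mat_mul]
      split_ifs with hkl
      · subst hkl; simp
      · simp [hkl]
    simp [this]
  rw [hc] at htr
  simp only [Matrix.trace_smul, Matrix.trace_one, Fintype.card_fin, smul_eq_mul] at htr
  rw [← average_single_apply, hc, Matrix.smul_apply, Matrix.one_apply]
  by_cases hkl : k = l <;> by_cases hij : i = j <;> simp [hkl, hij] at htr ⊢
  · exact eq_inv_of_mul_eq_one_left htr
  · exact htr.resolve_right π.dim_pos.ne'

lemma Irrep.integral_conj_char_mul_coord_of_not_equivalent {π π' : Irrep G}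
    (h : ¬ π.Equivalent π') (l j : Fin π.dim) :
    ∫ x, (starRingEnd ℂ) (π'.char x) * π.coord l j x ∂(normHaar G) = 0 := by
  simp only [char_eq, map_sum, Finset.sum_mul]
  rw [integral_finsetSum _ fun i _ => integrable_of_continuous (by fun_prop)]
  simp [integral_conj_coord_mul_coord_of_not_equivalent h]

lemma Irrep.integral_conj_char_mul_coord (π : Irrep G) (l j : Fin π.dim) :
    ∫ x, (starRingEnd ℂ) (π.char x) * π.coord l j x ∂(normHaar G)
      = if l = j then (π.dim : ℂ)⁻¹ else 0 := by
  simp only [char_eq, map_sum, Finset.sum_mul]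
  rw [integral_finsetSum _ fun i _ => integrable_of_continuous (by fun_prop)]
  simp only [integral_conj_coord_mul_coord]
  split_ifs with h
  · subst h; simp
  · exact Finset.sum_eq_zero fun i _ => if_neg fun hi => h (hi.1.symm.trans hi.2)

lemma Irrep.integral_conj_char_mul_char (π : Irrep G) :
    ∫ x, (starRingEnd ℂ) (π.char x) * π.char x ∂(normHaar G) = 1 := by
  have hd : (π.dim : ℂ) ≠ 0 := by exact_mod_cast π.dim_pos.ne'
  conv_lhs => enter [2, x, 2]; rw [π.char_eq x]
  simp only [Finset.mul_sum]
  rw [integral_finsetSum _ fun i _ => integrable_of_continuous (by fun_prop)]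
  simp [integral_conj_char_mul_coord, hd]

lemma Irrep.integral_conj_char_mul_char_of_not_equivalent {π π' : Irrep G}
    (h : ¬ π.Equivalent π') :
    ∫ x, (starRingEnd ℂ) (π'.char x) * π.char x ∂(normHaar G) = 0 := by
  conv_lhs => enter [2, x, 2]; rw [π.char_eq x]
  simp only [Finset.mul_sum]
  rw [integral_finsetSum _ fun i _ => integrable_of_continuous (by fun_prop)]
  simp [integral_conj_char_mul_coord_of_not_equivalent h]

end Haar

/-! ### Compact operators into `C(X)` -/

section InnerOperator

variable {X H : Type*} [TopologicalSpace X] [CompactSpace X] [NormedAddCommGroup H]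
    [InnerProductSpace ℂ H]

/-- The operator `f ↦ (x ↦ ⟪φ x, f⟫)` into the bounded continuous functions. -/
noncomputable def innerOperatorAux (φ : C(X, H)) : H →L[ℂ] (BoundedContinuousFunction X ℂ) :=
  LinearMap.mkContinuous
    { toFun := fun f => BoundedContinuousFunction.mkOfCompact
        ⟨fun x => inner ℂ (φ x) f, φ.continuous.inner continuous_const⟩
      map_add' := fun f g => by ext x; simp
      map_smul' := fun c f => by ext x; simp }
    ‖φ‖ fun f => by
      refine (BoundedContinuousFunction.norm_le (by positivity)).2 fun x => ?_
      exact (norm_inner_le_norm _ _).trans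
        (mul_le_mul_of_nonneg_right (φ.norm_coe_le_norm x) (norm_nonneg _))

/-- Arzelà–Ascoli: on the unit ball the images are bounded by `‖φ‖`, and they are equicontinuous
because `|⟪φ x - φ x₀, f⟫| ≤ ‖φ x - φ x₀‖`. -/
lemma isCompactOperator_innerOperatorAux (φ : C(X, H)) :
    IsCompactOperator (innerOperatorAux φ) := by
  refine (isCompactOperator_iff_isCompact_closure_image_closedBall
    (innerOperatorAux φ : H →ₗ[ℂ] BoundedContinuousFunction X ℂ) one_pos).2 ?_
  refine BoundedContinuousFunction.arzela_ascoli (Metric.closedBall 0 ‖φ‖)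
    (isCompact_closedBall _ _) _ ?_ ?_
  · rintro _ x ⟨f, hf, rfl⟩
    rw [mem_closedBall_zero_iff] at hf ⊢
    refine (norm_inner_le_norm _ _).trans ?_
    exact (mul_le_mul (φ.norm_coe_le_norm x) hf (norm_nonneg _) (norm_nonneg _)).trans (by simp)
  · intro x₀
    rw [Metric.equicontinuousAt_iff_right]
    intro ε hε
    filter_upwards [Metric.continuousAt_iff'.1 φ.continuous.continuousAt ε hε] with x hx
    rintro ⟨_, f, hf, rfl⟩
    rw [mem_closedBall_zero_iff] at hf
    change dist (inner ℂ (φ x₀) f) (inner ℂ (φ x) f) < ε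
    rw [dist_comm, dist_eq_norm, ← inner_sub_left]
    rw [dist_eq_norm] at hx
    refine lt_of_le_of_lt (norm_inner_le_norm _ _) (lt_of_le_of_lt ?_ hx)
    exact mul_le_of_le_one_right (norm_nonneg _) hf

/-- The operator `f ↦ (x ↦ ⟪φ x, f⟫)` into the continuous functions. -/
noncomputable def innerOperator (φ : C(X, H)) : H →L[ℂ] C(X, ℂ) :=
  ((ContinuousMap.linearIsometryBoundedOfCompact X ℂ ℂ).symm.toContinuousLinearEquiv :
    BoundedContinuousFunction X ℂ →L[ℂ] C(X, ℂ)).comp (innerOperatorAux φ)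

lemma isCompactOperator_innerOperator (φ : C(X, H)) : IsCompactOperator (innerOperator φ) :=
  IsCompactOperator.clm_comp (isCompactOperator_innerOperatorAux φ)
    ((ContinuousMap.linearIsometryBoundedOfCompact X ℂ ℂ).symm.toContinuousLinearEquiv :
      BoundedContinuousFunction X ℂ →L[ℂ] C(X, ℂ))

end InnerOperator

/-! ### Translation-invariant subspaces of `C(G)` and the representations they carry -/

section Translation

variable {G : Type*} [Group G] [TopologicalSpace G] [IsTopologicalGroup G]

/-- Left translation `(L_g f)(x) = f(g⁻¹x)` of continuous functions. -/
noncomputable def leftTranslate (g : G) : C(G, ℂ) →ₗ[ℂ] C(G, ℂ) where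
  toFun f := ⟨fun x => f (g⁻¹ * x), by fun_prop⟩
  map_add' _ _ := rfl
  map_smul' _ _ := rfl

@[simp] lemma leftTranslate_apply (g : G) (f : C(G, ℂ)) (x : G) :
    leftTranslate g f x = f (g⁻¹ * x) := rfl

@[simp] lemma leftTranslate_one (f : C(G, ℂ)) : leftTranslate 1 f = f := by ext; simp

lemma leftTranslate_mul (g h : G) (f : C(G, ℂ)) :
    leftTranslate (g * h) f = leftTranslate g (leftTranslate h f) := by
  ext; simp [mul_assoc]

lemma continuous_leftTranslate (f : C(G, ℂ)) : Continuous fun g : G => leftTranslate g f :=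
  ContinuousMap.continuous_of_continuous_uncurry _ <| by
    change Continuous fun p : G × G => f (p.1⁻¹ * p.2)
    fun_prop

/-- Subspaces of `C(G)` invariant under all left translations. -/
def IsTranslationInvariant (W : Submodule ℂ C(G, ℂ)) : Prop :=
  ∀ g : G, ∀ f ∈ W, leftTranslate g f ∈ W

lemma IsTranslationInvariant.exists_minimal {E : Submodule ℂ C(G, ℂ)} [FiniteDimensional ℂ E]
    (hE : E ≠ ⊥) (hinv : IsTranslationInvariant E) :
    ∃ W ≤ E, W ≠ ⊥ ∧ IsTranslationInvariant W ∧
      ∀ W' ≤ W, IsTranslationInvariant W' → W' = ⊥ ∨ W' = W := by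
  classical
  have hex : ∃ n, ∃ W ≤ E, W ≠ ⊥ ∧ IsTranslationInvariant W ∧ Module.finrank ℂ W = n :=
    ⟨_, E, le_rfl, hE, hinv, rfl⟩
  obtain ⟨W, hWE, hW, hWinv, hn⟩ := Nat.find_spec hex
  refine ⟨W, hWE, hW, hWinv, fun W' hW'W hW' => or_iff_not_imp_left.2 fun hne => ?_⟩
  have : FiniteDimensional ℂ W := Submodule.finiteDimensional_of_le hWE
  refine Submodule.eq_of_le_of_finrank_le hW'W ?_
  rw [hn]
  exact Nat.find_min' hex ⟨W', hW'W.trans hWE, hne, hW', rfl⟩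

end Translation

section Coefficients

variable {G : Type*} [Group G] [TopologicalSpace G] [IsTopologicalGroup G]
    [CompactSpace G] [MeasurableSpace G] [BorelSpace G]

/-- The class in `L²(G)` of a continuous function. -/
noncomputable abbrev toL2 : C(G, ℂ) →L[ℂ] Lp ℂ 2 (normHaar G) :=
  ContinuousMap.toLp 2 (normHaar G) ℂ

lemma toL2_injective : Function.Injective (toL2 (G := G)) :=
  ContinuousMap.toLp_injective (normHaar G)

lemma inner_toL2 (f g : C(G, ℂ)) :
    inner ℂ (toL2 f) (toL2 g) = ∫ x, g x * (starRingEnd ℂ) (f x) ∂(normHaar G) :=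
  ContinuousMap.inner_toLp (normHaar G) f g

lemma inner_leftTranslate (g : G) (f₁ f₂ : C(G, ℂ)) :
    inner ℂ (toL2 (leftTranslate g f₁)) (toL2 (leftTranslate g f₂))
      = inner ℂ (toL2 f₁) (toL2 f₂) := by
  rw [inner_toL2, inner_toL2]
  exact integral_mul_left_eq_self (μ := normHaar G)
    (fun x => f₂ x * (starRingEnd ℂ) (f₁ x)) g⁻¹

/-- Orthonormality is meant in `L²`, but the basis and the expansion live in `C(G)`, so pointwise
evaluation stays available; injectivity of `toL2` allows the passage back. -/
lemma exists_orthonormal_basis_of_continuous (W : Submodule ℂ C(G, ℂ)) [FiniteDimensional ℂ W] :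
    ∃ (n : ℕ) (w : Fin n → C(G, ℂ)), (∀ i, w i ∈ W) ∧ Orthonormal ℂ (fun i => toL2 (w i)) ∧
      ∀ f ∈ W, ∑ i, (inner ℂ (toL2 (w i)) (toL2 f) : ℂ) • w i = f := by
  let V : Submodule ℂ (Lp ℂ 2 (normHaar G)) := W.map (toL2 (G := G)).toLinearMap
  let b := stdOrthonormalBasis ℂ V
  have hb : ∀ i, ∃ f ∈ W, toL2 f = (b i : Lp ℂ 2 (normHaar G)) := fun i => (b i).2
  choose w hw hwb using hb
  refine ⟨_, w, hw, ?_, fun f hf => toL2_injective ?_⟩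
  · simp only [hwb]
    exact b.orthonormal.comp_linearIsometry V.subtypeₗᵢ
  · have h := congrArg (Subtype.val) (b.sum_repr' (⟨toL2 f, f, hf, rfl⟩ : V))
    simp only [Submodule.coe_sum, Submodule.coe_smul, Submodule.coe_inner] at h
    simp only [map_sum, map_smul, hwb]
    exact h

/-- A minimal translation-invariant subspace of `C(G)` carries an irreducible representation. -/
lemma exists_irrep_of_minimal {W : Submodule ℂ C(G, ℂ)} [FiniteDimensional ℂ W] (hW : W ≠ ⊥)
    (hinv : IsTranslationInvariant W)
    (hmin : ∀ W' ≤ W, IsTranslationInvariant W' → W' = ⊥ ∨ W' = W) :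
    ∃ (π : Irrep G) (w : Fin π.dim → C(G, ℂ)), (∀ i, w i ∈ W) ∧ (∀ i, w i ≠ 0) ∧
      ∀ g j, leftTranslate g (w j) = ∑ i, π.coord i j g • w i := by
  obtain ⟨n, w, hwW, hw, hrep⟩ := exists_orthonormal_basis_of_continuous W
  let M : G → Matrix (Fin n) (Fin n) ℂ := fun g =>
    Matrix.of fun i j => inner ℂ (toL2 (w i)) (toL2 (leftTranslate g (w j)))
  have hM : ∀ g j, leftTranslate g (w j) = ∑ i, M g i j • w i := fun g j =>
    (hrep _ (hinv g _ (hwW j))).symm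
  have hcoef : ∀ (c : Fin n → ℂ) i, inner ℂ (toL2 (w i)) (toL2 (∑ k, c k • w k)) = c i := by
    intro c i
    simp only [map_sum, map_smul]
    exact hw.inner_right_fintype c i
  have hM1 : M 1 = 1 := by
    ext i j
    simp only [M, Matrix.of_apply, leftTranslate_one, Matrix.one_apply]
    exact orthonormal_iff_ite.1 hw i j
  have hMmul : ∀ g h, M (g * h) = M g * M h := by
    intro g h
    ext i j
    have : leftTranslate (g * h) (w j) = ∑ i, (M g * M h) i j • w i := by
      rw [leftTranslate_mul, hM h j]
      simp only [map_sum, map_smul, hM g, Finset.smul_sum, Matrix.mul_apply, Finset.sum_smul,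
        smul_smul]
      rw [Finset.sum_comm]
      exact Finset.sum_congr rfl fun _ _ => Finset.sum_congr rfl fun _ _ => by rw [mul_comm]
    change inner ℂ (toL2 (w i)) (toL2 (leftTranslate (g * h) (w j))) = _
    rw [this, hcoef (fun k => (M g * M h) k j)]
  -- Unitarity: left translation preserves the `L²` inner product.
  have hMstar : ∀ g, star (M g) = M g⁻¹ := by
    intro g
    ext i j
    change (starRingEnd ℂ) (inner ℂ (toL2 (w j)) (toL2 (leftTranslate g (w i))))
      = inner ℂ (toL2 (w i)) (toL2 (leftTranslate g⁻¹ (w j)))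
    rw [inner_conj_symm, ← inner_leftTranslate g (w i), ← leftTranslate_mul]
    simp
  have hcont : Continuous M := continuous_matrix fun i j =>
    continuous_const.inner ((toL2 (G := G)).continuous.comp (continuous_leftTranslate (w j)))
  have hpos : 0 < n := by
    rcases Nat.eq_zero_or_pos n with rfl | h
    · refine absurd ((Submodule.eq_bot_iff W).2 fun f hf => ?_) hW
      rw [← hrep f hf]; simp
    · exact h
  -- `Θ` is an equivariant injection with image `W`, so it carries invariant subspaces of `ℂⁿ` to
  -- invariant subspaces of `W`, and minimality gives irreducibility.
  let Θ : (Fin n → ℂ) →ₗ[ℂ] C(G, ℂ) := Fintype.linearCombination ℂ w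
  have hΘ : ∀ v, Θ v = ∑ i, v i • w i := fun v => Fintype.linearCombination_apply ℂ w v
  have hΘinj : Function.Injective Θ := by
    intro u v huv
    ext i
    rw [← hcoef u i, ← hcoef v i, ← hΘ, ← hΘ, huv]
  have hΘtop : (⊤ : Submodule ℂ (Fin n → ℂ)).map Θ = W := by
    refine le_antisymm ?_ fun f hf => ⟨_, trivial, (hΘ _).trans (hrep f hf)⟩
    rintro _ ⟨v, -, rfl⟩
    rw [hΘ]
    exact W.sum_mem fun i _ => W.smul_mem _ (hwW i)
  have hΘM : ∀ g v, leftTranslate g (Θ v) = Θ ((M g).mulVec v) := by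
    intro g v
    simp only [hΘ, map_sum, map_smul, hM g, Finset.smul_sum, Matrix.mulVec, dotProduct,
      Finset.sum_smul, smul_smul]
    rw [Finset.sum_comm]
    exact Finset.sum_congr rfl fun _ _ => Finset.sum_congr rfl fun _ _ => by rw [mul_comm]
  let R : G →* Matrix.unitaryGroup (Fin n) ℂ :=
    { toFun := fun g => ⟨M g, by
        rw [Matrix.mem_unitaryGroup_iff', hMstar, ← hMmul, inv_mul_cancel, hM1]⟩
      map_one' := Subtype.ext hM1
      map_mul' := fun g h => Subtype.ext (hMmul g h) }
  have hR : Continuous R := hcont.subtype_mk fun g => (R g).2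
  refine ⟨{
    dim := n
    dim_pos := hpos
    rep := R
    continuous_rep := hR
    irreducible := fun U hU => ?_ }, w, hwW, fun i h0 => ?_, hM⟩
  · have hU' : IsTranslationInvariant (U.map Θ) := by
      rintro g _ ⟨v, hv, rfl⟩
      exact ⟨_, hU g v hv, (hΘM g v).symm⟩
    rcases hmin _ ((Submodule.map_mono le_top).trans hΘtop.le) hU' with h | h
    · left
      exact Submodule.map_injective_of_injective hΘinj (h.trans (Submodule.map_bot Θ).symm)
    · right
      exact Submodule.map_injective_of_injective hΘinj (h.trans hΘtop.symm)
  · exact hw.ne_zero i (by rw [h0, map_zero])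

end Coefficients

/-! ### The Peter–Weyl theorem -/

section PeterWeyl

variable {G : Type*} [Group G] [TopologicalSpace G] [IsTopologicalGroup G]
    [CompactSpace G] [MeasurableSpace G] [BorelSpace G]

/-- The kernel `x ↦ (y ↦ conj F(y⁻¹x))` of the convolution with `F`. -/
noncomputable def convolutionKernel (F : C(G, ℂ)) : C(G, Lp ℂ 2 (normHaar G)) :=
  (⟨toL2, toL2.continuous⟩ : C(C(G, ℂ), Lp ℂ 2 (normHaar G))).comp
    (ContinuousMap.curry ⟨fun p : G × G => (starRingEnd ℂ) (F (p.2⁻¹ * p.1)), by fun_prop⟩)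

/-- The operator `f ↦ ∫ F(y⁻¹x) f(y) dy` from `L²(G)` to `C(G)`. -/
noncomputable def convolutionOperator (F : C(G, ℂ)) : Lp ℂ 2 (normHaar G) →L[ℂ] C(G, ℂ) :=
  innerOperator (convolutionKernel F)

/-- The inner product conjugates its first argument, which cancels the conjugate in
`convolutionKernel`. -/
lemma convolutionOperator_toL2 (F f : C(G, ℂ)) (x : G) :
    convolutionOperator F (toL2 f) x = ∫ y, F (y⁻¹ * x) * f y ∂(normHaar G) := by
  have h : convolutionOperator F (toL2 f) x = inner ℂ (toL2 ((ContinuousMap.curry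
      ⟨fun p : G × G => (starRingEnd ℂ) (F (p.2⁻¹ * p.1)), by fun_prop⟩ : C(G, C(G, ℂ))) x))
      (toL2 f) := rfl
  rw [h, inner_toL2]
  simp [mul_comm]

lemma convolutionOperator_leftTranslate (F f : C(G, ℂ)) (g : G) :
    convolutionOperator F (toL2 (leftTranslate g f))
      = leftTranslate g (convolutionOperator F (toL2 f)) := by
  ext x
  rw [leftTranslate_apply, convolutionOperator_toL2, convolutionOperator_toL2,
    ← integral_mul_left_eq_self _ g]
  simp [mul_assoc]

/-- Convolution with a continuous function, as an operator on `L²(G)`. -/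
noncomputable def convolutionL2 (F : C(G, ℂ)) : Lp ℂ 2 (normHaar G) →L[ℂ] Lp ℂ 2 (normHaar G) :=
  toL2.comp (convolutionOperator F)

lemma isCompactOperator_convolutionL2 (F : C(G, ℂ)) : IsCompactOperator (convolutionL2 F) :=
  IsCompactOperator.clm_comp (isCompactOperator_innerOperator (convolutionKernel F)) toL2

lemma denseRange_toL2 [T2Space G] : DenseRange (toL2 (G := G)) :=
  ContinuousMap.toLp_denseRange ℂ (normHaar G) ℂ (by simp)

/-- By density it suffices to test continuous functions, where Fubini applies and the kernel
`F(y⁻¹x)` is Hermitian. -/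
lemma convolutionL2_isSymmetric [T2Space G] {F : C(G, ℂ)}
    (hF : ∀ x, F x⁻¹ = (starRingEnd ℂ) (F x)) :
    (convolutionL2 F).toLinearMap.IsSymmetric := by
  intro u v
  refine DenseRange.induction_on₂ denseRange_toL2
    (p := fun u v => inner ℂ (convolutionL2 F u) v = inner ℂ u (convolutionL2 F v))
    (isClosed_eq (by fun_prop) (by fun_prop)) (fun f g => ?_) u v
  simp only [convolutionL2, ContinuousLinearMap.comp_apply, inner_toL2, convolutionOperator_toL2]
  simp only [← integral_conj, ← integral_const_mul, ← integral_mul_const]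
  rw [integral_integral_swap_of_hasCompactSupport
    (by simp only [Function.uncurry_def]; fun_prop) (HasCompactSupport.of_compactSpace _)]
  congr 1
  ext y
  congr 1
  ext x
  have : F (x⁻¹ * y) = (starRingEnd ℂ) (F (y⁻¹ * x)) := by rw [← hF]; simp
  rw [this, map_mul]
  ring

lemma eq_zero_of_integral_conj_mul_self {F : C(G, ℂ)}
    (h : ∫ x, (starRingEnd ℂ) (F x) * F x ∂(normHaar G) = 0) : F = 0 := by
  apply toL2_injective
  rw [map_zero, ← inner_self_eq_zero (𝕜 := ℂ), inner_toL2, ← h]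
  simp only [mul_comm]

/-- After a change of variables the convolution at `x` is `∫ F(y) w_j(xy⁻¹) dy`, and `y ↦ w_j(xy⁻¹)`
is a combination of the `π_ik`. -/
lemma convolutionOperator_eq_zero_of_forall_irrep {F : C(G, ℂ)}
    (h : ∀ (π : Irrep G) (i j), ∫ x, F x * π.coord i j x ∂(normHaar G) = 0) {π : Irrep G}
    {w : Fin π.dim → C(G, ℂ)} (hw : ∀ g j, leftTranslate g (w j) = ∑ i, π.coord i j g • w i)
    (j : Fin π.dim) : convolutionOperator F (toL2 (w j)) = 0 := by
  ext x
  rw [convolutionOperator_toL2, ← integral_mul_left_eq_self _ x, ← integral_inv_eq_self]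
  have hwj : ∀ y, w j (x * y⁻¹) = ∑ i, ∑ k, π.coord i k y * (π.coord k j x⁻¹ * w i 1) := by
    intro y
    have h1 : w j (x * y⁻¹) = leftTranslate (y * x⁻¹) (w j) 1 := by simp
    rw [h1, hw, ContinuousMap.sum_apply]
    refine Finset.sum_congr rfl fun i _ => ?_
    rw [ContinuousMap.smul_apply, ← π.mat_apply, π.mat_mul, Matrix.mul_apply, smul_eq_mul,
      Finset.sum_mul]
    simp only [π.mat_apply, mul_assoc]
  have hint : ∀ i k, Integrable
      (fun y => F y * (π.coord i k y * (π.coord k j x⁻¹ * w i 1))) (normHaar G) := fun i k =>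
    integrable_of_continuous (by fun_prop)
  simp only [hwj, mul_inv_rev, inv_inv, inv_mul_cancel_right, Finset.mul_sum]
  rw [integral_finsetSum _ fun i _ => integrable_finsetSum _ fun k _ => hint i k]
  refine Finset.sum_eq_zero fun i _ => ?_
  rw [integral_finsetSum _ fun k _ => hint i k]
  refine Finset.sum_eq_zero fun k _ => ?_
  simp only [← mul_assoc, integral_mul_const, h, zero_mul]

/-- **Peter–Weyl**: a Hermitian continuous function on a compact group which is orthogonal to all
coordinate functions of irreducible representations vanishes. -/
theorem eq_zero_of_forall_irrep [T2Space G] {F : C(G, ℂ)}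
    (hF : ∀ x, F x⁻¹ = (starRingEnd ℂ) (F x))
    (h : ∀ (π : Irrep G) (i j), ∫ x, F x * π.coord i j x ∂(normHaar G) = 0) : F = 0 := by
  by_contra hF0
  -- The convolution of `F` with itself takes the value `∫ |F|²` at `1`.
  have hA : convolutionL2 F ≠ 0 := by
    intro hA
    apply hF0
    have h0 : convolutionOperator F (toL2 F) = 0 := toL2_injective <| by
      rw [map_zero]
      exact congrArg (fun T => T (toL2 F)) hA
    apply eq_zero_of_integral_conj_mul_self
    rw [← ContinuousMap.zero_apply (1 : G), ← h0, convolutionOperator_toL2]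
    simp [hF]
  have hcpt := isCompactOperator_convolutionL2 F
  rw [Ne, ← ContinuousLinearMap.eq_zero_of_forall_hasEigenvalue_eq_zero hcpt
    (convolutionL2_isSymmetric hF)] at hA
  push Not at hA
  obtain ⟨c, hc, hc0⟩ := hA
  have hfd := ContinuousLinearMap.finite_dimensional_eigenspace hcpt c hc0
  -- Since `c ≠ 0`, eigenvectors in `L²` have continuous representatives, so the eigenspace can be
  -- taken inside `C(G)`.
  let B : Module.End ℂ C(G, ℂ) := (convolutionOperator F).toLinearMap.comp toL2.toLinearMap
  have hB : ∀ f, f ∈ B.eigenspace c ↔ convolutionOperator F (toL2 f) = c • f := fun f =>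
    Module.End.mem_eigenspace_iff
  have hE : B.eigenspace c ≠ ⊥ := by
    obtain ⟨v, hv⟩ := hc.exists_hasEigenvector
    have hv1 : toL2 (convolutionOperator F v) = c • v := hv.apply_eq_smul
    refine (Submodule.ne_bot_iff _).2 ⟨convolutionOperator F v, ?_, fun h0 => ?_⟩
    · rw [hB, hv1, map_smul]
    · rw [h0, map_zero] at hv1
      exact (smul_ne_zero hc0 hv.2) hv1.symm
  have hEfd : FiniteDimensional ℂ (B.eigenspace c) := by
    let j : B.eigenspace c →ₗ[ℂ] Module.End.eigenspace (convolutionL2 F).toLinearMap c :=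
      (toL2.toLinearMap).restrict fun f hf => by
        rw [Module.End.mem_eigenspace_iff]
        change toL2 (convolutionOperator F (toL2 f)) = c • toL2 f
        rw [(hB f).1 hf, map_smul]
    exact Module.Finite.of_injective j fun a b hab =>
      Subtype.ext (toL2_injective (congrArg Subtype.val hab))
  have hEinv : IsTranslationInvariant (B.eigenspace c) := by
    intro g f hf
    rw [hB] at hf ⊢
    rw [convolutionOperator_leftTranslate, hf, map_smul]
  obtain ⟨W, hWE, hW, hWinv, hmin⟩ := hEinv.exists_minimal hE
  have hWfd : FiniteDimensional ℂ W := Submodule.finiteDimensional_of_le hWE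
  obtain ⟨π, w, hwW, hw0, hw⟩ := exists_irrep_of_minimal hW hWinv hmin
  have h1 := (hB _).1 (hWE (hwW ⟨0, π.dim_pos⟩))
  rw [convolutionOperator_eq_zero_of_forall_irrep h hw] at h1
  exact smul_ne_zero hc0 (hw0 _) h1.symm

end PeterWeyl

/-! ### One-parameter semigroups of real numbers -/

/-- A continuous one-parameter semigroup of real numbers `≤ 1` is `t ↦ exp (tα)` with `α ≤ 0`. -/
lemma exists_exp_of_semigroup {c : ℝ≥0 → ℝ} (hc : Continuous c) (h0 : c 0 = 1)
    (hadd : ∀ s t, c (s + t) = c s * c t) (hle : ∀ t, c t ≤ 1) :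
    ∃ α ≤ 0, ∀ t : ℝ≥0, c t = Real.exp (t * α) := by
  have hnsmul : ∀ (n : ℕ) s, c (n * s) = c s ^ n := by
    intro n s
    induction n with
    | zero => simp [h0]
    | succ n ih => rw [Nat.cast_succ, add_mul, one_mul, hadd, ih, pow_succ]
  -- `c (t / n)` tends to `c 0 = 1`, so it is positive for some `n > 0`, and `c t` is its `n`-th
  -- power.
  have hpos : ∀ t, 0 < c t := by
    intro t
    have hlim : Tendsto (fun n : ℕ => c (t / n)) atTop (nhds 1) := by
      rw [← h0]
      exact (hc.tendsto 0).comp (tendsto_const_div_atTop_nhds_zero_nat t)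
    obtain ⟨n, hn, hn0⟩ := ((hlim.eventually_const_lt one_pos).and (eventually_gt_atTop 0)).exists
    have hn1 : (n : ℝ≥0) ≠ 0 := by exact_mod_cast hn0.ne'
    have := hnsmul n (t / n)
    rw [mul_div_cancel₀ _ hn1] at this
    rw [this]
    exact pow_pos hn n
  let l : ℝ≥0 →+ ℝ :=
    { toFun := fun t => Real.log (c t)
      map_zero' := by simp [h0]
      map_add' := fun s t => by rw [hadd, Real.log_mul (hpos s).ne' (hpos t).ne'] }
  have hlcont : Continuous l := hc.log fun t => (hpos t).ne'
  -- Additivity gives linearity on rationals; the approximants `⌊tn⌋ / n` and continuity give the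
  -- rest.
  have hlin : ∀ t : ℝ≥0, l t = t * l 1 := by
    have hrat : ∀ k n : ℕ, 0 < n → l (k / n) = ((k / n : ℝ≥0) : ℝ) * l 1 := by
      intro k n hn
      have hn0 : (n : ℝ≥0) ≠ 0 := by exact_mod_cast hn.ne'
      have hn1 : (n : ℝ) ≠ 0 := by exact_mod_cast hn.ne'
      have h1 : n • l (k / n) = k • l 1 := by
        rw [← map_nsmul, ← map_nsmul, nsmul_eq_mul, nsmul_eq_mul, mul_div_cancel₀ _ hn0, mul_one]
      rw [nsmul_eq_mul, nsmul_eq_mul] at h1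
      push_cast
      field_simp
      linarith
    intro t
    have hfloor : Tendsto (fun n : ℕ => (⌊(t : ℝ) * n⌋₊ : ℝ≥0) / n) atTop (nhds t) := by
      rw [← NNReal.tendsto_coe]
      push_cast
      exact (tendsto_nat_floor_mul_div_atTop t.2).comp tendsto_natCast_atTop_atTop
    have hcoe : Continuous fun t : ℝ≥0 => (t : ℝ) * l 1 := by fun_prop
    refine tendsto_nhds_unique ((hlcont.tendsto t).comp hfloor)
      (((hcoe.tendsto t).comp hfloor).congr' ?_)
    filter_upwards [eventually_gt_atTop 0] with n hn
    exact (hrat _ n hn).symm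
  refine ⟨l 1, Real.log_nonpos (hpos 1).le (hle 1), fun t => ?_⟩
  rw [← hlin]
  exact (Real.exp_log (hpos t)).symm

lemma Irrep.Equivalent.dim_eq {G : Type*} [Group G] [TopologicalSpace G] {π π' : Irrep G} (h : π.Equivalent π') : π.dim = π'.dim := by
  obtain ⟨T, -⟩ := h
  simpa using T.finrank_eq

/-! ### Fourier transforms of central and symmetric measures -/

section Fourier

variable {G : Type*} [Group G] [TopologicalSpace G] [MeasurableSpace G]

lemma fourier_apply (μ : Measure G) (π : Irrep G) (i j : Fin π.dim) :
    fourier μ π i j = ∫ x, π.coord i j x ∂μ := rfl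

lemma trace_fourier [CompactSpace G] [BorelSpace G] (μ : Measure G) [IsFiniteMeasure μ] (π : Irrep G) :
    (fourier μ π).trace = ∫ x, π.char x ∂μ := by
  simp only [Irrep.char_eq]
  rw [integral_finsetSum _ fun i _ => integrable_of_continuous (by fun_prop)]
  rfl

lemma norm_fourier_apply_le (μ : Measure G) [IsProbabilityMeasure μ] (π : Irrep G)
    (i j : Fin π.dim) : ‖fourier μ π i j‖ ≤ 1 := by
  simpa [fourier_apply] using norm_integral_le_of_norm_le_const (μ := μ)
    (Eventually.of_forall (π.norm_coord_le i j))

lemma fourier_dirac_one [T2Space G] [BorelSpace G] (π : Irrep G) : fourier (Measure.dirac (1 : G)) π = 1 := by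
  ext i j
  rw [fourier_apply, integral_dirac, ← π.mat_apply, π.mat_one]

end Fourier

section Invariance

variable {G : Type*} [Group G] [TopologicalSpace G] [IsTopologicalGroup G] [MeasurableSpace G]
    [BorelSpace G]

lemma IsCentral.integral_conj {μ : Measure G} (h : IsCentral μ) {f : G → ℂ} (hf : Continuous f)
    (g : G) : ∫ x, f (g * x * g⁻¹) ∂μ = ∫ x, f x ∂μ := by
  have hc : Continuous fun x : G => g * x * g⁻¹ := by fun_prop
  have hmap : Measure.map (fun x => g * x * g⁻¹) μ = μ := by
    ext A hA
    rw [Measure.map_apply hc.measurable hA, ← h g⁻¹ A hA]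
    congr 1
    ext x
    constructor
    · exact fun hx => ⟨_, hx, by group⟩
    · rintro ⟨y, hy, rfl⟩
      simpa [mul_assoc] using hy
  conv_rhs => rw [← hmap]
  rw [integral_map hc.measurable.aemeasurable hf.aestronglyMeasurable]

lemma IsSymmetric.integral_inv {μ : Measure G} (h : IsSymmetric μ) {f : G → ℂ}
    (hf : Continuous f) : ∫ x, f x⁻¹ ∂μ = ∫ x, f x ∂μ := by
  have hmap : Measure.map (fun x : G => x⁻¹) μ = μ := by
    ext A hA
    rw [Measure.map_apply measurable_inv hA, ← h A hA, Set.image_inv_eq_inv]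
    rfl
  conv_rhs => rw [← hmap]
  rw [integral_map measurable_inv.aemeasurable hf.aestronglyMeasurable]

lemma IsSymmetric.conj_fourier_apply {μ : Measure G} (h : IsSymmetric μ) (π : Irrep G)
    (i j : Fin π.dim) : (starRingEnd ℂ) (fourier μ π i j) = fourier μ π j i := by
  rw [fourier_apply, fourier_apply, ← integral_conj, ← h.integral_inv (π.continuous_coord j i)]
  simp only [Irrep.coord_inv]

end Invariance

/-! ### The exponents of the convolution semigroup -/

section Semigroup

variable {G : Type*} [Group G] [TopologicalSpace G] [IsTopologicalGroup G]
    [CompactSpace G] [MeasurableSpace G] [BorelSpace G]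

/-- Replacing `x` by `gxg⁻¹` turns `π(xg)` into `π(gx)` under the integral. -/
lemma IsCentral.fourier_commute {μ : Measure G} [IsFiniteMeasure μ] (h : IsCentral μ)
    (π : Irrep G) (g : G) : fourier μ π * π.mat g = π.mat g * fourier μ π := by
  have hi : ∀ i j, Integrable (fun x => π.mat x i j) μ := fun i j =>
    integrable_of_continuous (π.continuous_coord i j)
  change (Matrix.of fun i j => ∫ x, π.mat x i j ∂μ) * π.mat g
    = π.mat g * (Matrix.of fun i j => ∫ x, π.mat x i j ∂μ)
  rw [← matrix_integral_mul_left _ _ hi, ← matrix_integral_mul_right _ _ hi]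
  ext i j
  simp only [Matrix.of_apply, ← π.mat_mul]
  rw [← h.integral_conj (f := fun x => π.mat (x * g) i j)
    ((π.continuous_mat.comp (continuous_mul_const g)).matrix_elem i j) g]
  simp

lemma IsConvolution.fourier_eq {θ μ ν : Measure G} [IsFiniteMeasure θ] [IsFiniteMeasure μ]
    [IsFiniteMeasure ν] (h : IsConvolution θ μ ν) (π : Irrep G) :
    fourier θ π = fourier μ π * fourier ν π := by
  have hin : ∀ i j σ, ∫ τ, π.coord i j (σ * τ) ∂ν = ∑ l, π.coord i l σ * fourier ν π l j := by
    intro i j σ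
    simp only [← π.mat_apply, π.mat_mul, Matrix.mul_apply]
    simp only [π.mat_apply]
    rw [integral_finsetSum _ fun l _ => integrable_of_continuous (by fun_prop)]
    simp only [integral_const_mul, fourier_apply]
  have hout : ∀ i j, ∫ σ, ∑ l, π.coord i l σ * fourier ν π l j ∂μ
      = (fourier μ π * fourier ν π) i j := by
    intro i j
    rw [integral_finsetSum _ fun l _ => integrable_of_continuous (by fun_prop)]
    simp only [integral_mul_const, Matrix.mul_apply, fourier_apply]
  have hcoord : ∀ i j σ, Integrable (fun τ => π.coord i j (σ * τ)) ν := fun i j σ =>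
    integrable_of_continuous (by fun_prop)
  have hsum : ∀ i j, Integrable (fun σ => ∑ l, π.coord i l σ * fourier ν π l j) μ := fun i j =>
    integrable_of_continuous (by fun_prop)
  ext i j
  have hθ : Integrable (π.coord i j) θ := integrable_of_continuous (by fun_prop)
  -- `IsConvolution` tests real functions only, so real and imaginary parts are treated separately.
  apply Complex.ext
  · have h1 := h ⟨fun x => (π.coord i j x).re, by fun_prop⟩
    have h2 : ∀ σ, ∫ τ, (π.coord i j (σ * τ)).re ∂ν = (∑ l, π.coord i l σ * fourier ν π l j).re :=
      fun σ => (integral_re (hcoord i j σ)).trans (by rw [hin]; rfl)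
    simp only [ContinuousMap.coe_mk, h2] at h1
    rw [← hout, fourier_apply]
    exact (integral_re hθ).symm.trans (h1.trans (integral_re (hsum i j)))
  · have h1 := h ⟨fun x => (π.coord i j x).im, by fun_prop⟩
    have h2 : ∀ σ, ∫ τ, (π.coord i j (σ * τ)).im ∂ν = (∑ l, π.coord i l σ * fourier ν π l j).im :=
      fun σ => (integral_im (hcoord i j σ)).trans (by rw [hin]; rfl)
    simp only [ContinuousMap.coe_mk, h2] at h1
    rw [← hout, fourier_apply]
    exact (integral_im hθ).symm.trans (h1.trans (integral_im (hsum i j)))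

lemma exists_fourier_eq_real_smul {μ : Measure G} [IsFiniteMeasure μ] (hc : IsCentral μ)
    (hs : IsSymmetric μ) (π : Irrep G) :
    ∃ c : ℝ, fourier μ π = (c : ℂ) • (1 : Matrix (Fin π.dim) (Fin π.dim) ℂ) := by
  obtain ⟨z, hz⟩ := π.schur_scalar _ (hc.fourier_commute π)
  have h0 := hs.conj_fourier_apply π ⟨0, π.dim_pos⟩ ⟨0, π.dim_pos⟩
  rw [hz] at h0
  obtain ⟨c, hc⟩ := Complex.conj_eq_iff_real.1 (by simpa using h0)
  exact ⟨c, hc ▸ hz⟩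

lemma IsConvolutionSemigroup.exists_exponent [T2Space G] {μ : ℝ≥0 → ProbabilityMeasure G}
    (hμ : IsConvolutionSemigroup μ) (hcentral : ∀ t, IsCentral (μ t : Measure G))
    (hsymm : ∀ t, IsSymmetric (μ t : Measure G)) (π : Irrep G) :
    ∃ α ≤ 0, ∀ t, fourier (μ t : Measure G) π =
      (Real.exp ((t : ℝ) * α) : ℂ) • (1 : Matrix (Fin π.dim) (Fin π.dim) ℂ) := by
  choose c hc using fun t => exists_fourier_eq_real_smul (hcentral t) (hsymm t) π
  let o : Fin π.dim := ⟨0, π.dim_pos⟩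
  have hc0 : ∀ t, fourier (μ t : Measure G) π o o = c t := fun t => by rw [hc]; simp
  have hcont : Continuous c := by
    have hre : c = fun t => ∫ x, (π.coord o o x).re ∂(μ t : Measure G) := by
      ext t
      have hi : Integrable (π.coord o o) (μ t : Measure G) :=
        integrable_of_continuous (by fun_prop)
      exact (Complex.ofReal_re _).symm.trans
        ((congrArg Complex.re (hc0 t).symm).trans (integral_re hi).symm)
    rw [hre, continuous_iff_continuousAt]
    intro t
    exact ProbabilityMeasure.tendsto_iff_forall_integral_tendsto.1 (hμ.continuous.tendsto t)
      (BoundedContinuousFunction.mkOfCompact ⟨fun x => (π.coord o o x).re, by fun_prop⟩)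
  obtain ⟨α, hα, h⟩ := exists_exp_of_semigroup hcont
    (by
      have := hc0 0
      rw [hμ.zero, fourier_dirac_one, Matrix.one_apply_eq] at this
      exact_mod_cast this.symm)
    (fun s t => by
      have := hc0 (s + t)
      rw [(hμ.add s t).fourier_eq, hc, hc] at this
      simp only [smul_mul_smul_comm, mul_one, Matrix.smul_apply, Matrix.one_apply_eq,
        smul_eq_mul] at this
      exact_mod_cast this.symm)
    (fun t => by
      have := norm_fourier_apply_le (μ t : Measure G) π o o
      rw [hc0, Complex.norm_real] at this
      exact (le_abs_self _).trans this)
  exact ⟨α, hα, fun t => by rw [hc, h]⟩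

/-- The exponent descends to classes: equivalent representations have equal characters and
dimensions, so comparing traces identifies the scalars. -/
lemma IsConvolutionSemigroup.exists_exponent_unitaryDual [T2Space G]
    {μ : ℝ≥0 → ProbabilityMeasure G} (hμ : IsConvolutionSemigroup μ)
    (hcentral : ∀ t, IsCentral (μ t : Measure G)) (hsymm : ∀ t, IsSymmetric (μ t : Measure G)) :
    ∃ α : UnitaryDual G → ℝ, (∀ p, α p ≤ 0) ∧ ∀ (t : ℝ≥0) (π : Irrep G),
      fourier (μ t : Measure G) π =
        (Real.exp ((t : ℝ) * α π.cls) : ℂ) • (1 : Matrix (Fin π.dim) (Fin π.dim) ℂ) := by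
  choose β hβ hfour using hμ.exists_exponent hcentral hsymm
  refine ⟨fun p => β (Quotient.out p), fun p => hβ _, fun t π => ?_⟩
  have heq : (Quotient.out π.cls).Equivalent π := Irrep.cls_eq_iff.1 (Quotient.out_eq π.cls)
  have htr := trace_fourier (μ t : Measure G) (Quotient.out π.cls)
  rw [heq.char_eq, ← trace_fourier, hfour, hfour] at htr
  have hd : (π.dim : ℂ) ≠ 0 := by exact_mod_cast π.dim_pos.ne'
  simp only [Matrix.trace_smul, Matrix.trace_one, Fintype.card_fin, smul_eq_mul,
    heq.dim_eq] at htr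
  rw [hfour, mul_right_cancel₀ hd htr]

end Semigroup

/-! ### Continuous densities and their character expansion -/

section Density

variable {G : Type*} [Group G] [TopologicalSpace G] [IsTopologicalGroup G]
    [CompactSpace G] [MeasurableSpace G] [BorelSpace G]

lemma HasDensity.integral_eq {μ : Measure G} [IsFiniteMeasure μ] {k : G → ℝ}
    (h : HasDensity μ k) (f : G → ℂ) :
    ∫ x, (k x : ℂ) * f x ∂(normHaar G) = ∫ x, f x ∂μ := by
  rw [← integral_rnDeriv_smul h.1]
  refine integral_congr_ae ?_
  filter_upwards [h.2] with x hx
  rw [hx, Complex.real_smul]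

/-- For `D(x) = k(x⁻¹) - k(x)`, symmetry of `μ` gives `∫ |D|² = ∫ D(x⁻¹) dμ - ∫ D dμ = 0`;
continuity gives equality everywhere. -/
lemma HasDensity.apply_inv {μ : Measure G} [IsFiniteMeasure μ] {k : G → ℝ}
    (h : HasDensity μ k) (hk : Continuous k) (hs : IsSymmetric μ) (x : G) : k x⁻¹ = k x := by
  let D : C(G, ℂ) := ⟨fun x => (k x⁻¹ : ℂ) - k x, by fun_prop⟩
  have hD : D = 0 := by
    apply eq_zero_of_integral_conj_mul_self
    have hDc : Continuous fun x => D x := D.continuous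
    have h1 : ∀ x, (starRingEnd ℂ) (D x) * D x = (k x⁻¹ : ℂ) * D x - (k x : ℂ) * D x := by
      intro x
      simp only [D, ContinuousMap.coe_mk, map_sub, Complex.conj_ofReal]
      ring
    simp only [h1]
    rw [integral_sub (integrable_of_continuous (by fun_prop))
      (integrable_of_continuous (by fun_prop)), h.integral_eq, sub_eq_zero,
      ← integral_inv_eq_self]
    simp only [inv_inv]
    rw [h.integral_eq]
    exact hs.integral_inv hDc
  have := congrArg (fun f : C(G, ℂ) => f x) hD
  simp only [D, ContinuousMap.coe_mk, ContinuousMap.zero_apply, sub_eq_zero] at this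
  exact_mod_cast this

end Density

section Series

variable {G : Type*} [Group G] [TopologicalSpace G] [IsTopologicalGroup G]
    [CompactSpace G] [MeasurableSpace G] [BorelSpace G]

/-- The character as a continuous map. -/
noncomputable def Irrep.charMap (π : Irrep G) : C(G, ℂ) := ⟨π.char, π.continuous_char⟩

lemma orthonormal_char {rep : UnitaryDual G → Irrep G} (hrep : ∀ p, (rep p).cls = p) :
    Orthonormal ℂ fun p => toL2 (rep p).charMap := by
  classical
  rw [orthonormal_iff_ite]
  intro p q
  rw [inner_toL2]
  simp only [Irrep.charMap, ContinuousMap.coe_mk, mul_comm (Irrep.char _ _)]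
  split_ifs with h
  · subst h
    exact (rep p).integral_conj_char_mul_char
  · refine Irrep.integral_conj_char_mul_char_of_not_equivalent fun he => h ?_
    rw [← hrep p, ← hrep q, Irrep.cls_eq_iff.2 he]

/-- Bessel's inequality for the characters. -/
lemma summable_dim_sq_mul {rep : UnitaryDual G → Irrep G} (hrep : ∀ p, (rep p).cls = p)
    {μ : Measure G} [IsFiniteMeasure μ] {k : G → ℝ} (h : HasDensity μ k) (hk : Continuous k)
    {c : UnitaryDual G → ℝ}
    (hc : ∀ π : Irrep G, fourier μ π = (c π.cls : ℂ) • (1 : Matrix (Fin π.dim) (Fin π.dim) ℂ)) :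
    Summable fun p => ((rep p).dim : ℝ) ^ 2 * c p ^ 2 := by
  let K : C(G, ℂ) := ⟨fun x => (k x : ℂ), by fun_prop⟩
  refine ((orthonormal_char hrep).inner_products_summable (x := toL2 K)).congr fun p => ?_
  -- The coefficient is the conjugate of the trace of the scalar matrix `fourier μ (rep p)`.
  have h1 : inner ℂ (toL2 (rep p).charMap) (toL2 K) = (((rep p).dim * c p : ℝ) : ℂ) := by
    rw [inner_toL2]
    change ∫ x, (k x : ℂ) * (starRingEnd ℂ) ((rep p).char x) ∂(normHaar G) = _
    rw [h.integral_eq, integral_conj, ← trace_fourier, hc, hrep]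
    simp [mul_comm]
  rw [h1, Complex.norm_real, Real.norm_eq_abs, sq_abs, mul_pow]

/-- A continuous symmetric density with scalar Fourier coefficients is the sum of its Fourier
series, if that series converges absolutely. -/
lemma HasDensity.hasSum_char [T2Space G] {rep : UnitaryDual G → Irrep G}
    (hrep : ∀ p, (rep p).cls = p)
    {μ : Measure G} [IsFiniteMeasure μ] {k : G → ℝ} (h : HasDensity μ k) (hk : Continuous k)
    (hs : IsSymmetric μ) {c : UnitaryDual G → ℝ} (hc0 : ∀ p, 0 ≤ c p)
    (hc : ∀ π : Irrep G, fourier μ π = (c π.cls : ℂ) • (1 : Matrix (Fin π.dim) (Fin π.dim) ℂ))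
    (hsum : Summable fun p => ((rep p).dim : ℝ) ^ 2 * c p) (x : G) :
    HasSum (fun p => ((rep p).dim : ℂ) * (c p : ℂ) * (rep p).char x) (k x : ℂ) := by
  -- Conjugate characters are used because Peter–Weyl pairs with `π_ij` without conjugation;
  -- evaluating at `x⁻¹` undoes this at the end.
  let term : UnitaryDual G → C(G, ℂ) := fun p =>
    (((rep p).dim : ℂ) * (c p : ℂ)) • star (rep p).charMap
  have hterm : ∀ p y, term p y
      = ((rep p).dim : ℂ) * (c p : ℂ) * (starRingEnd ℂ) ((rep p).char y) := fun p y => rfl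
  have hS : Summable term := by
    refine Summable.of_norm_bounded hsum fun p => ?_
    refine (ContinuousMap.norm_le _ (by have := hc0 p; positivity)).2 fun y => ?_
    rw [hterm, norm_mul, norm_mul, Complex.norm_real, Real.norm_of_nonneg (hc0 p),
      Complex.norm_natCast, RCLike.norm_conj]
    have h1 := (rep p).norm_char_le y
    have h2 : 0 ≤ ((rep p).dim : ℝ) * c p := mul_nonneg (Nat.cast_nonneg _) (hc0 p)
    nlinarith
  have hSx : ∀ y, HasSum (fun p => term p y) ((∑' p, term p) y) := fun y =>
    ContinuousMap.hasSum_apply hS.hasSum y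
  let K : C(G, ℂ) := ⟨fun x => (k x : ℂ), by fun_prop⟩
  have hF : K - ∑' p, term p = 0 := by
    refine eq_zero_of_forall_irrep (fun y => ?_) fun π i j => ?_
    · have h1 : (∑' p, term p) y⁻¹ = (starRingEnd ℂ) ((∑' p, term p) y) := by
        refine (hSx y⁻¹).unique (((hSx y).map (starRingEnd ℂ) Complex.continuous_conj).congr_fun ?_)
        intro p
        simp [hterm, Irrep.char_inv]
      rw [ContinuousMap.sub_apply, ContinuousMap.sub_apply, h1, map_sub]
      simp [K, h.apply_inv hk hs]
    · let P : C(G, ℂ) := ⟨fun x => (starRingEnd ℂ) (π.coord i j x), by fun_prop⟩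
      have hP : ∀ f : C(G, ℂ), inner ℂ (toL2 P) (toL2 f) = ∫ x, f x * π.coord i j x ∂(normHaar G) :=
        -- As an inner product the pairing is continuous, so it passes through the series; Schur
        -- orthogonality leaves only the class of `π`.
        fun f => by rw [inner_toL2]; simp [P]
      have hsumP : HasSum (fun p => (inner ℂ (toL2 P) (toL2 (term p)) : ℂ))
          (inner ℂ (toL2 P) (toL2 (∑' p, term p))) :=
        hS.hasSum.mapL ((innerSL ℂ (toL2 P)).comp toL2)
      have hval : ∀ p, (inner ℂ (toL2 P) (toL2 (term p)) : ℂ) =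
          ((rep p).dim : ℂ) * (c p : ℂ)
            * ∫ x, (starRingEnd ℂ) ((rep p).char x) * π.coord i j x ∂(normHaar G) := fun p => by
        rw [hP, ← integral_const_mul]
        simp only [hterm, mul_assoc]
      have hne : ∀ p, p ≠ π.cls → (inner ℂ (toL2 P) (toL2 (term p)) : ℂ) = 0 := fun p hp => by
        rw [hval, Irrep.integral_conj_char_mul_coord_of_not_equivalent, mul_zero]
        exact fun he => hp (by rw [← hrep p, Irrep.cls_eq_iff.2 he])
      have heq : (rep π.cls).Equivalent π := Irrep.cls_eq_iff.1 (hrep _)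
      have hd : (π.dim : ℂ) ≠ 0 := by exact_mod_cast π.dim_pos.ne'
      have h2 := hsumP.unique (hasSum_single π.cls hne)
      rw [hval, heq.char_eq, heq.dim_eq, π.integral_conj_char_mul_coord] at h2
      rw [← hP, map_sub, inner_sub_right, h2, hP]
      change ∫ x, (k x : ℂ) * π.coord i j x ∂(normHaar G) - _ = 0
      rw [h.integral_eq, ← fourier_apply, hc, Matrix.smul_apply, Matrix.one_apply, smul_eq_mul]
      split_ifs
      · field_simp
        simp
      · simp
  have hKx : (∑' p, term p) x⁻¹ = k x := by
    rw [← sub_eq_zero.1 hF]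
    simp [K, h.apply_inv hk hs]
  rw [← hKx]
  refine (hSx x⁻¹).congr_fun fun p => ?_
  simp [hterm, Irrep.char_inv]

end Series

end CptGroup

theorem theorem5p6 {G : Type*} [Group G] [TopologicalSpace G] [IsTopologicalGroup G]
    [CompactSpace G] [T2Space G] [MeasurableSpace G] [BorelSpace G]
    (μ : ℝ≥0 → ProbabilityMeasure G) (hμ : CptGroup.IsConvolutionSemigroup μ)
    (hcentral : ∀ t, CptGroup.IsCentral (μ t : Measure G))
    (hsymm : ∀ t, CptGroup.IsSymmetric (μ t : Measure G))
    (k : ℝ≥0 → G → ℝ)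
    (hdens : ∀ t, 0 < t → CptGroup.HasDensity (μ t : Measure G) (k t))
    (hcont : ∀ t, 0 < t → Continuous (k t)) :
    ∃ α : CptGroup.UnitaryDual G → ℝ,
      (∀ p, α p ≤ 0) ∧
      (∀ (t : ℝ≥0) (π : CptGroup.Irrep G),
        CptGroup.fourier (μ t : Measure G) π =
          (Real.exp ((t : ℝ) * α π.cls) : ℂ) • (1 : Matrix (Fin π.dim) (Fin π.dim) ℂ)) ∧
      ∀ rep : CptGroup.UnitaryDual G → CptGroup.Irrep G, (∀ p, (rep p).cls = p) →
        ∀ t : ℝ≥0, 0 < t →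
          TendstoUniformly
            (fun (s : Finset (CptGroup.UnitaryDual G)) (x : G × G) =>
              ∑ p ∈ s, ∑ i : Fin (rep p).dim, ∑ j : Fin (rep p).dim,
                ((rep p).dim : ℂ) * (Real.exp ((t : ℝ) * α p) : ℂ) *
                  (starRingEnd ℂ) ((rep p).coord i j x.1) * (rep p).coord i j x.2)
            (fun x : G × G => (CptGroup.transitionDensity (k t) x.1 x.2 : ℂ))
            atTop := by
  obtain ⟨α, hα, hfour⟩ := hμ.exists_exponent_unitaryDual hcentral hsymm
  refine ⟨α, hα, hfour, fun rep hrep t ht => ?_⟩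
  -- Bessel at time `t / 2`, where the squared coefficient `exp ((t/2)α)²` is `exp (tα)`.
  have hsum : Summable fun p => ((rep p).dim : ℝ) ^ 2 * Real.exp ((t : ℝ) * α p) := by
    have ht2 : 0 < t / 2 := half_pos ht
    refine (CptGroup.summable_dim_sq_mul hrep (hdens _ ht2) (hcont _ ht2)
      (c := fun p => Real.exp (((t / 2 : ℝ≥0) : ℝ) * α p)) (hfour (t / 2))).congr fun p => ?_
    rw [← Real.exp_nat_mul]
    congr 2
    push_cast
    ring
  have hterm : ∀ p (x : G × G), ∑ i : Fin (rep p).dim, ∑ j : Fin (rep p).dim,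
      ((rep p).dim : ℂ) * (Real.exp ((t : ℝ) * α p) : ℂ) *
        (starRingEnd ℂ) ((rep p).coord i j x.1) * (rep p).coord i j x.2
      = ((rep p).dim : ℂ) * (Real.exp ((t : ℝ) * α p) : ℂ) * (rep p).char (x.1⁻¹ * x.2) := by
    intro p x
    rw [← CptGroup.Irrep.sum_conj_coord_mul_coord]
    simp only [Finset.mul_sum, mul_assoc]
  have hlim : (fun x : G × G => (CptGroup.transitionDensity (k t) x.1 x.2 : ℂ)) = fun x =>
      ∑' p, ((rep p).dim : ℂ) * (Real.exp ((t : ℝ) * α p) : ℂ) * (rep p).char (x.1⁻¹ * x.2) := by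
    ext x
    exact (((hdens t ht).hasSum_char hrep (hcont t ht) (hsymm t) (fun p => (Real.exp_pos _).le)
      (hfour t) hsum (x.1⁻¹ * x.2)).tsum_eq).symm
  simp only [hterm]
  rw [hlim]
  -- Weierstrass M-test; one factor `d_π` of the majorant comes from `|χ_π| ≤ d_π`.
  refine tendstoUniformly_tsum hsum fun p x => ?_
  rw [norm_mul, norm_mul, Complex.norm_real, Real.norm_of_nonneg (Real.exp_pos _).le,
    Complex.norm_natCast, sq, mul_right_comm]
  gcongr
  exact (rep p).norm_char_le _
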